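/- Let $\Omega\subseteq\mathbb{C}$ be a simply connected open set, that is, an open set whose complement $(\mathbb{C}\cup\{\infty\})\setminus\Omega$ in the Riemann sphere is connected ($\Omega$ itself need not be connected). Let $\Omega\cup\{\alpha\}$ be the one-point compactification of $\Omega$, and let $F\subseteq\Omega$ be an Arakelian set in $\Omega$, that is, a relatively closed subset of $\Omega$ such that (i) $(\Omega\cup\{\alpha\})\setminus F$ is connected, and (ii) $(\Omega\cup\{\alpha\})\setminus F$ is locally connected at $\alpha$: every neighbourhood $U$ of $\alpha$ in $\Omega\cup\{\alpha\}$ contains a neighbourhood $W$ of $\alpha$ in $\Omega\cup\{\alpha\}$ such that $W\setminus F$ is connected. Let $A(F)$ denote the set of functions $F\to\mathbb{C}$ that are continuous on $F$ and holomorphic in the interior $F^\circ$ of $F$. If $f\in A(F)$ satisfies $f(z)\neq 0$ for all $z\in F$, then there exists $g\in A(F)$ such that $f(z)=e^{g(z)}$ for all $z\in F$. -/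

import Mathlib

open Set Topology

/-- `Ω ⊆ ℂ` is a simply connected open set: it is open and its complement `(ℂ ∪ {∞}) \ Ω` in the
Riemann sphere is connected. As usual with this definition, `Ω` itself need not be connected. -/
def IsSimplyConnectedOpen (Ω : Set ℂ) : Prop :=
  IsOpen Ω ∧ IsConnected ((fun z : ℂ => (z : OnePoint ℂ)) '' Ω)ᶜ

/-- The set `(Ω ∪ {α}) \ F` in the one-point compactification `Ω ∪ {α}` of the subspace `Ω`;
the added point `α` is `OnePoint.infty`. -/
def onePointDiff (Ω F : Set ℂ) : Set (OnePoint Ω) :=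
  ((fun z : Ω => (z : OnePoint Ω)) '' {z : Ω | (z : ℂ) ∈ F})ᶜ

/-- The subspace `S` of `X` is locally connected at `x`: inside every neighbourhood of `x` there
is a neighbourhood of `x` whose trace on `S` is connected. -/
def IsLocallyConnectedAt {X : Type*} [TopologicalSpace X] (S : Set X) (x : X) : Prop :=
  ∀ U ∈ 𝓝 x, ∃ W ∈ 𝓝 x, W ⊆ U ∧ IsConnected (W ∩ S)

/-- `F` is an Arakelian set in the open set `Ω`: a relatively closed subset of `Ω` such that
`(Ω ∪ {α}) \ F` is connected, and locally connected at `α`. -/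
structure IsArakelian (Ω F : Set ℂ) : Prop where
  subset : F ⊆ Ω
  isClosed : IsClosed {z : Ω | (z : ℂ) ∈ F}
  isConnected : IsConnected (onePointDiff Ω F)
  isLocallyConnectedAt : IsLocallyConnectedAt (onePointDiff Ω F) OnePoint.infty

/-- `A(F)`: the functions continuous on `F` and holomorphic in the interior of `F`. A function on
`F` is represented by any function on `ℂ` with the given values on `F`; the values off `F` do not
matter. -/
def spaceA (F : Set ℂ) : Set (ℂ → ℂ) :=
  {f | ContinuousOn f F ∧ DifferentiableOn ℂ f (interior F)}

/-! Call a bounded open set disjoint from `T` with frontier in `T` a hole of `T`. The topological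
core is `HasLog.of_noHole`: on a compact plane set `K` without holes, zero-free continuous functions
have continuous logarithms. For `z - p` with `p ∉ K` this holds because the bad `p` would form a
hole. In general, logarithms on vertical strips are glued. On a common line they differ by `2πi`
times a locally constant integer function, a combination of steps at points off `K`, and logarithms
of the `z - p` correct each step.

`IsArakelian.exists_extension` then extends `f` to a zero-free continuous function on `Ω`. Condition
(i) says that `F` has no holes; condition (ii) confines the holes of `F ∪ K`, for compact `K ⊆ Ω`,
to a compact subset of `Ω`. Filling the holes of `F ∪ exhaust Ω n` gives increasing hole-free sets
that cover `Ω`, and the function is extended from each to the next: take a logarithm on a compact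
part, extend it by Tietze and exponentiate.

The members of the exhaustion have no holes either, so the extension has logarithms on them.
Normalised at a base point of each component, these give a logarithm on `Ω`, which is holomorphic
wherever `f` is. -/

/-- Continuous induction for properties of compact intervals. -/
theorem interval_induction {P : ℝ → ℝ → Prop}
    (mono : ∀ a b c d, a ≤ c → d ≤ b → P a b → P c d)
    (join : ∀ a b c, a ≤ b → b ≤ c → P a b → P b c → P a c)
    (nhds : ∀ x, ∃ ε > 0, P (x - ε) (x + ε)) (a b : ℝ) (hab : a ≤ b) : P a b := by
  have key : Icc a b ⊆ {t | P a t} := by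
    refine IsClosed.Icc_subset_of_forall_exists_gt ?_ ?_ ?_
    · refine isClosed_of_closure_subset fun x hx => ?_
      have hxI : x ∈ Icc a b := isClosed_Icc.closure_subset_iff.2 inter_subset_right hx
      refine ⟨?_, hxI⟩
      obtain ⟨ε, hε, h⟩ := nhds x
      obtain ⟨t, ⟨ht, htI⟩, hd⟩ := Metric.mem_closure_iff.1 hx ε hε
      rw [Real.dist_eq, abs_lt] at hd
      rcases le_total t x with htx | htx
      · exact join a t x htI.1 htx ht (mono _ _ _ _ (by linarith) (by linarith) h)
      · exact mono _ _ _ _ le_rfl htx ht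
    · obtain ⟨ε, hε, h⟩ := nhds a
      exact mono _ _ _ _ (by linarith) (by linarith) h
    · rintro x ⟨hx, hxI⟩ y hy
      obtain ⟨ε, hε, h⟩ := nhds x
      rw [mem_Ioi] at hy
      refine ⟨min y (x + ε), ?_, lt_min hy (by linarith), min_le_left _ _⟩
      exact join a x _ hxI.1 (le_min hy.le (by linarith)) hx
        (mono _ _ _ _ (by linarith) (min_le_right _ _) h)
  exact key ⟨hab, le_rfl⟩

/-! ### Continuous logarithms and linear factors -/

/-- `f` has a continuous logarithm on `K`. -/
def HasLog (f : ℂ → ℂ) (K : Set ℂ) : Prop :=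
  ∃ g : ℂ → ℂ, ContinuousOn g K ∧ ∀ z ∈ K, Complex.exp (g z) = f z

theorem HasLog.mono {f : ℂ → ℂ} {K L : Set ℂ} (h : HasLog f K) (hL : L ⊆ K) : HasLog f L := by
  obtain ⟨g, hg, hgf⟩ := h
  exact ⟨g, hg.mono hL, fun z hz => hgf z (hL hz)⟩

theorem HasLog.const {c : ℂ} (hc : c ≠ 0) (K : Set ℂ) : HasLog (fun _ => c) K :=
  ⟨fun _ => Complex.log c, continuousOn_const, fun _ _ => Complex.exp_log hc⟩

/-- The quotient `f / h` stays within distance less than 1 of 1, where the principal logarithm is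
continuous. -/
theorem HasLog.of_close {f h : ℂ → ℂ} {K : Set ℂ} (hh : HasLog h K) (hf : ContinuousOn f K)
    (hfh : ∀ z ∈ K, ‖f z - h z‖ < ‖h z‖) : HasLog f K := by
  obtain ⟨g, hg, hgh⟩ := hh
  have hmem : ∀ z ∈ K, f z * Complex.exp (-g z) ∈ Complex.slitPlane := by
    intro z hz
    have h0 : h z ≠ 0 := fun h0 => by
      have := hfh z hz
      rw [h0, norm_zero] at this
      exact absurd this (not_lt.2 (norm_nonneg _))
    have : f z * Complex.exp (-g z) = 1 + (f z - h z) / h z := by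
      rw [Complex.exp_neg, hgh z hz]
      field_simp
      ring
    rw [this]
    refine Complex.mem_slitPlane_of_norm_lt_one ?_
    rw [norm_div, div_lt_one (norm_pos_iff.2 h0)]
    exact hfh z hz
  refine ⟨fun z => Complex.log (f z * Complex.exp (-g z)) + g z, ?_, fun z hz => ?_⟩
  · exact ((hf.mul (hg.neg.cexp)).clog hmem).add hg
  · rw [Complex.exp_add, Complex.exp_log (Complex.slitPlane_ne_zero (hmem z hz)), mul_assoc,
      ← Complex.exp_add, neg_add_cancel, Complex.exp_zero, mul_one]

/-- No nonempty bounded open set disjoint from `T` has its frontier in `T`. -/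
def NoHole (T : Set ℂ) : Prop :=
  ∀ V : Set ℂ, IsOpen V → Bornology.IsBounded V → frontier V ⊆ T → Disjoint V T → V = ∅

/-- Off `K`, existence of the logarithm is locally constant in `p`, and it holds for large `p`,
where `z - p` is close to the constant `-p`. The exceptional `p` therefore form a hole of `K`. -/
theorem HasLog.sub_const_of_noHole {K : Set ℂ} (hK : IsCompact K) (hN : NoHole K) {p : ℂ}
    (hp : p ∉ K) : HasLog (fun z => z - p) K := by
  have step : ∀ p q : ℂ, (∀ z ∈ K, dist p q < dist z p) → HasLog (fun z => z - p) K →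
      HasLog (fun z => z - q) K := by
    intro p q hpq h
    refine h.of_close (by fun_prop) fun z hz => ?_
    have := hpq z hz
    rw [dist_eq_norm, dist_eq_norm] at this
    simpa using this
  have near : ∀ p, p ∉ K → ∃ δ > 0, ∀ q, dist p q < δ →
      q ∉ K ∧ (HasLog (fun z => z - p) K ↔ HasLog (fun z => z - q) K) := by
    intro p hp
    obtain ⟨δ, hδ, hb⟩ := Metric.isOpen_iff.1 hK.isClosed.isOpen_compl p hp
    have hd : ∀ z ∈ K, δ ≤ dist z p := fun z hz => not_lt.1 fun h => hb h hz
    refine ⟨δ / 2, half_pos hδ, fun q hq => ⟨fun hqK => ?_, ?_, ?_⟩⟩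
    · have := hd q hqK
      rw [dist_comm] at this
      linarith
    · exact step p q fun z hz => by linarith [hd z hz]
    · refine step q p fun z hz => ?_
      have := dist_triangle z q p
      have := hd z hz
      rw [dist_comm q p] at *
      linarith
  by_contra hlog
  have hV : {p | p ∉ K ∧ ¬ HasLog (fun z => z - p) K} = ∅ := by
    refine hN _ ?_ ?_ ?_ ?_
    · rw [Metric.isOpen_iff]
      rintro q ⟨hq, hql⟩
      obtain ⟨δ, hδ, h⟩ := near q hq
      refine ⟨δ, hδ, fun r hr => ?_⟩
      have := h r (by rwa [dist_comm])
      exact ⟨this.1, fun hl => hql (this.2.2 hl)⟩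
    · obtain ⟨R, hR⟩ := hK.isBounded.subset_closedBall 0
      refine Metric.isBounded_closedBall (x := (0 : ℂ)) (r := R) |>.subset ?_
      rintro q ⟨-, hql⟩
      by_contra hqR
      refine hql ?_
      rw [mem_closedBall_zero_iff, not_le] at hqR
      rcases eq_or_ne q 0 with rfl | hq0
      · refine ⟨0, continuousOn_const, fun z hz => ?_⟩
        have := hR hz
        rw [mem_closedBall_zero_iff] at this
        rw [norm_zero] at hqR
        linarith [norm_nonneg z]
      refine (HasLog.const (neg_ne_zero.2 hq0) K).of_close (by fun_prop) fun z hz => ?_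
      have := hR hz
      rw [mem_closedBall_zero_iff] at this
      simpa using this.trans_lt hqR
    · intro q hq
      by_contra hqK
      have hq2 := hq.2
      obtain ⟨δ, hδ, h⟩ := near q hqK
      obtain ⟨r, hr, hd⟩ := Metric.mem_closure_iff.1 hq.1 δ hδ
      refine hq2 (mem_interior_iff_mem_nhds.2 ?_)
      refine Filter.mem_of_superset (Metric.ball_mem_nhds q hδ) fun s hs => ?_
      have h1 := h r hd
      have h2 := h s (by rwa [dist_comm])
      exact ⟨h2.1, fun hl => hr.2 (h1.2.1 (h2.2.2 hl))⟩
    · exact disjoint_left.2 fun q hq => hq.1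
  exact (hV ▸ (⟨hp, hlog⟩ : p ∈ {p | p ∉ K ∧ ¬ HasLog (fun z => z - p) K}) : p ∈ (∅ : Set ℂ))

/-! ### Integer jumps along a vertical line -/

/-- The integer combinations of the steps `1_{t < p}` with `p ∉ J` and of constants. -/
def stepSpan (J : Set ℝ) : AddSubgroup (ℝ → ℤ) :=
  AddSubgroup.closure ({u | ∃ p ∉ J, u = fun t => if t < p then 1 else 0} ∪ {fun _ => 1})

theorem const_mem_stepSpan (J : Set ℝ) (n : ℤ) : (fun _ => n) ∈ stepSpan J := by
  have h : (fun _ => 1 : ℝ → ℤ) ∈ stepSpan J := AddSubgroup.subset_closure (Or.inr rfl)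
  convert (stepSpan J).zsmul_mem h n using 1
  ext t
  simp

theorem step_mem_stepSpan {J : Set ℝ} {p : ℝ} (hp : p ∉ J) (n : ℤ) :
    (fun t => if t < p then n else 0) ∈ stepSpan J := by
  have h : (fun t => if t < p then 1 else 0 : ℝ → ℤ) ∈ stepSpan J :=
    AddSubgroup.subset_closure (Or.inl ⟨p, hp, rfl⟩)
  convert (stepSpan J).zsmul_mem h n using 1
  ext t
  simp

theorem comp_mem_stepSpan {J : Set ℝ} {v : ℝ → ℤ} (hv : v ∈ stepSpan J) {φ : ℝ → ℝ}
    (hφ : ∀ p ∉ J, (fun t => if φ t < p then 1 else 0) ∈ stepSpan J) :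
    (fun t => v (φ t)) ∈ stepSpan J := by
  induction hv using AddSubgroup.closure_induction with
  | mem x hx =>
    rcases hx with ⟨p, hp, rfl⟩ | rfl
    · exact hφ p hp
    · exact const_mem_stepSpan J 1
  | zero => exact const_mem_stepSpan J 0
  | add x y _ _ hx hy => exact add_mem hx hy
  | neg x _ hx => exact neg_mem hx

theorem comp_min_mem_stepSpan {J : Set ℝ} {v : ℝ → ℤ} (hv : v ∈ stepSpan J) (e : ℝ) :
    (fun t => v (min t e)) ∈ stepSpan J := by
  refine comp_mem_stepSpan hv fun p hp => ?_
  by_cases h : e < p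
  · simpa [min_lt_iff, h] using const_mem_stepSpan J 1
  · simpa [min_lt_iff, h] using step_mem_stepSpan hp 1

theorem comp_max_mem_stepSpan {J : Set ℝ} {v : ℝ → ℤ} (hv : v ∈ stepSpan J) (e : ℝ) :
    (fun t => v (max t e)) ∈ stepSpan J := by
  refine comp_mem_stepSpan hv fun p hp => ?_
  by_cases h : e < p
  · simpa [max_lt_iff, h] using step_mem_stepSpan hp 1
  · simpa [max_lt_iff, h] using const_mem_stepSpan J 0

/-- A locally constant integer-valued function on a closed set is, on each compact interval, a
combination of steps located off the set. -/
theorem exists_mem_stepSpan {J : Set ℝ} (hJ : IsClosed J) {m : ℝ → ℤ} (hm : ContinuousOn m J)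
    {a b : ℝ} (hab : a ≤ b) : ∃ v ∈ stepSpan J, ∀ t ∈ J, a ≤ t → t ≤ b → v t = m t := by
  refine interval_induction (P := fun a b => ∃ v ∈ stepSpan J, ∀ t ∈ J, a ≤ t → t ≤ b → v t = m t)
    ?_ ?_ ?_ a b hab
  · rintro a b c d hac hdb ⟨v, hv, h⟩
    exact ⟨v, hv, fun t ht h1 h2 => h t ht (hac.trans h1) (h2.trans hdb)⟩
  · rintro a e b hae heb ⟨v, hv, hvm⟩ ⟨w, hw, hwm⟩
    -- Clamping `v` and `w` at `e` leaves only a jump of height `v e - w e` to correct. It vanishes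
    -- if `e ∈ J`, and otherwise a step at `e` is allowed.
    have hs : (fun t => if t < e then v e - w e else 0) ∈ stepSpan J := by
      by_cases he : e ∈ J
      · rw [hvm e he hae le_rfl, hwm e he le_rfl heb]
        simpa using const_mem_stepSpan J 0
      · exact step_mem_stepSpan he _
    refine ⟨_, add_mem (add_mem (comp_min_mem_stepSpan hv e) (comp_max_mem_stepSpan hw e))
      (sub_mem hs (const_mem_stepSpan J (v e))), fun t ht h1 h2 => ?_⟩
    rcases lt_or_ge t e with h | h
    · simp [h, h.le, hvm t ht h1 h.le]
    · simp [h, not_lt.2 h, hwm t ht h h2]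
  · intro x
    by_cases hx : x ∈ J
    · have := (hm x hx).eventually_mem ((isOpen_discrete {m x}).mem_nhds rfl)
      obtain ⟨ε, hε, h⟩ := Metric.mem_nhdsWithin_iff.1 this
      refine ⟨ε / 2, half_pos hε, _, const_mem_stepSpan J (m x), fun t ht h1 h2 => ?_⟩
      refine (h ⟨?_, ht⟩ : m t = m x).symm
      rw [Metric.mem_ball, Real.dist_eq, abs_lt]
      constructor <;> linarith
    · obtain ⟨ε, hε, h⟩ := Metric.isOpen_iff.1 hJ.isOpen_compl x hx
      refine ⟨ε / 2, half_pos hε, _, const_mem_stepSpan J 0, fun t ht h1 h2 => ?_⟩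
      refine absurd ht (h ?_)
      rw [Metric.mem_ball, Real.dist_eq, abs_lt]
      constructor <;> linarith

/-- For a step at `p`, subtract a logarithm of `z - (e + ip)` on `K` from branches of it on the two
closed half-planes. On the line the branches differ by `2πi` below `p` and agree above. -/
theorem exists_log_half_planes {K : Set ℂ} (hK : ∀ p ∉ K, HasLog (fun z => z - p) K) (e : ℝ)
    {v : ℝ → ℤ} (hv : v ∈ stepSpan {t : ℝ | (⟨e, t⟩ : ℂ) ∈ K}) :
    ∃ h₁ h₂ : ℂ → ℂ, ContinuousOn h₁ (K ∩ {z | z.re ≤ e}) ∧ ContinuousOn h₂ (K ∩ {z | e ≤ z.re}) ∧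
      (∀ z ∈ K, z.re ≤ e → Complex.exp (h₁ z) = 1) ∧
      (∀ z ∈ K, e ≤ z.re → Complex.exp (h₂ z) = 1) ∧
      ∀ z ∈ K, z.re = e → h₁ z - h₂ z = v z.im * (2 * Real.pi * Complex.I) := by
  induction hv using AddSubgroup.closure_induction with
  | mem x hx =>
    rcases hx with ⟨p, hp, rfl⟩ | rfl
    · obtain ⟨ρ, hρ, hρp⟩ := hK ⟨e, p⟩ hp
      have hne : ∀ z ∈ K, z - ⟨e, p⟩ ≠ 0 := fun z hz h0 => by
        rw [sub_eq_zero] at h0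
        rw [h0] at hz
        exact hp hz
      have hslit : ∀ w : ℂ, w ≠ 0 → 0 ≤ w.re → w ∈ Complex.slitPlane := by
        intro w hw hre
        rw [Complex.mem_slitPlane_iff]
        rcases hre.lt_or_eq with h | h
        · exact Or.inl h
        · exact Or.inr fun him => hw (Complex.ext h.symm him)
      have hs1 : ∀ z ∈ K ∩ {z : ℂ | z.re ≤ e}, -(z - ⟨e, p⟩) ∈ Complex.slitPlane :=
        fun z hz => hslit _ (neg_ne_zero.2 (hne z hz.1)) (by simpa using hz.2)
      have hs2 : ∀ z ∈ K ∩ {z : ℂ | e ≤ z.re}, z - ⟨e, p⟩ ∈ Complex.slitPlane :=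
        fun z hz => hslit _ (hne z hz.1) (by simpa using hz.2)
      refine ⟨fun z => Complex.log (-(z - ⟨e, p⟩)) + Real.pi * Complex.I - ρ z,
        fun z => Complex.log (z - ⟨e, p⟩) - ρ z, ?_, ?_, ?_, ?_, ?_⟩
      · exact ((ContinuousOn.clog (by fun_prop) hs1).add continuousOn_const).sub
          (hρ.mono inter_subset_left)
      · exact (ContinuousOn.clog (by fun_prop) hs2).sub (hρ.mono inter_subset_left)
      · intro z hz hre
        rw [Complex.exp_sub, Complex.exp_add, Complex.exp_log (neg_ne_zero.2 (hne z hz)),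
          Complex.exp_pi_mul_I, hρp z hz]
        field_simp [hne z hz]
      · intro z hz hre
        rw [Complex.exp_sub, Complex.exp_log (hne z hz), hρp z hz, div_self (hne z hz)]
      · intro z hz hre
        have him : z.im ≠ p := fun h => hne z hz (by
          rw [sub_eq_zero]
          exact Complex.ext hre h)
        simp only [add_sub_right_comm, sub_sub_sub_cancel_right]
        have hz' : z - ⟨e, p⟩ = ((z.im - p : ℝ) : ℂ) * Complex.I := by
          apply Complex.ext <;> simp [hre]
        have hI : ∀ r : ℝ, 0 < r → Complex.log (r * Complex.I) = Real.log r + Real.pi / 2 * Complex.I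
            ∧ Complex.log (-(r * Complex.I)) = Real.log r - Real.pi / 2 * Complex.I := by
          intro r hr
          rw [← mul_neg, Complex.log_ofReal_mul hr Complex.I_ne_zero,
            Complex.log_ofReal_mul hr (neg_ne_zero.2 Complex.I_ne_zero), Complex.log_I,
            Complex.log_neg_I]
          exact ⟨rfl, by ring⟩
        rcases lt_or_gt_of_ne him with h | h
        · have hr := hI (p - z.im) (by linarith)
          have : z - ⟨e, p⟩ = -(((p - z.im : ℝ) : ℂ) * Complex.I) := by
            rw [hz']
            push_cast
            ring
          rw [this, neg_neg, hr.1, hr.2, if_pos h]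
          push_cast
          ring
        · have hr := hI (z.im - p) (by linarith)
          rw [hz', hr.1, hr.2, if_neg h.le.not_gt]
          push_cast
          ring
    · refine ⟨fun _ => 2 * Real.pi * Complex.I, fun _ => 0, continuousOn_const, continuousOn_const,
        fun _ _ _ => Complex.exp_two_pi_mul_I, fun _ _ _ => Complex.exp_zero, fun _ _ _ => ?_⟩
      simp
  | zero =>
    exact ⟨0, 0, continuousOn_const, continuousOn_const, by simp, by simp, by simp⟩
  | add x y _ _ hx hy =>
    obtain ⟨h₁, h₂, c₁, c₂, e₁, e₂, hd⟩ := hx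
    obtain ⟨k₁, k₂, d₁, d₂, f₁, f₂, kd⟩ := hy
    refine ⟨h₁ + k₁, h₂ + k₂, c₁.add d₁, c₂.add d₂, fun z hz hre => ?_, fun z hz hre => ?_,
      fun z hz hre => ?_⟩
    · simp [Complex.exp_add, e₁ z hz hre, f₁ z hz hre]
    · simp [Complex.exp_add, e₂ z hz hre, f₂ z hz hre]
    · simp only [Pi.add_apply, Int.cast_add]
      linear_combination hd z hz hre + kd z hz hre
  | neg x _ hx =>
    obtain ⟨h₁, h₂, c₁, c₂, e₁, e₂, hd⟩ := hx
    refine ⟨-h₁, -h₂, c₁.neg, c₂.neg, fun z hz hre => ?_, fun z hz hre => ?_,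
      fun z hz hre => ?_⟩
    · simp [Complex.exp_neg, e₁ z hz hre]
    · simp [Complex.exp_neg, e₂ z hz hre]
    · simp only [Pi.neg_apply, Int.cast_neg]
      linear_combination -hd z hz hre

/-! ### Logarithms on compact plane sets without holes -/

theorem ContinuousOn.of_inter_isClosed {X Y : Type*} [TopologicalSpace X] [TopologicalSpace Y]
    {f : X → Y} {S A B : Set X} (hA : IsClosed A) (hB : IsClosed B)
    (hS : S ⊆ A ∪ B) (hfA : ContinuousOn f (S ∩ A)) (hfB : ContinuousOn f (S ∩ B)) :
    ContinuousOn f S := by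
  have aux : ∀ {C : Set X}, IsClosed C → ContinuousOn f (S ∩ C) → ∀ x ∈ S,
      ContinuousWithinAt f (S ∩ C) x := by
    intro C hC hf x hx
    by_cases hxC : x ∈ C
    · exact hf x ⟨hx, hxC⟩
    · exact continuousWithinAt_of_notMem_closure fun h =>
        hxC (hC.closure_subset_iff.2 inter_subset_right h)
  intro x hx
  have := (aux hA hfA x hx).union (aux hB hfB x hx)
  rwa [← inter_union_distrib_left, inter_eq_left.2 hS] at this

theorem exists_int_continuousOn {X : Type*} [TopologicalSpace X] {u : X → ℂ} {S : Set X}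
    (hu : ContinuousOn u S) (he : ∀ x ∈ S, Complex.exp (u x) = 1) :
    ∃ m : X → ℤ, ContinuousOn m S ∧ ∀ x ∈ S, u x = m x * (2 * Real.pi * Complex.I) := by
  choose! m hm using fun x hx => Complex.exp_eq_one_iff.1 (he x hx)
  refine ⟨m, fun x hx => ?_, hm⟩
  have : ∀ᶠ y in 𝓝[S] x, m y = m x := by
    have hd := Metric.tendsto_nhds.1 (hu x hx) 1 one_pos
    filter_upwards [hd, self_mem_nhdsWithin] with y hy hyS
    rw [hm x hx, hm y hyS, dist_eq_norm, ← sub_mul, norm_mul, ← Int.cast_sub,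
      Complex.norm_intCast] at hy
    have h2 : ‖(2 * Real.pi * Complex.I : ℂ)‖ = 2 * Real.pi := by
      simp [abs_of_pos Real.pi_pos]
    rw [h2] at hy
    by_contra hne
    have h1 : (1 : ℝ) ≤ |((m y - m x : ℤ) : ℝ)| := by
      exact_mod_cast Int.one_le_abs (sub_ne_zero.2 hne)
    nlinarith [Real.pi_gt_three]
  exact (tendsto_const_nhds (x := m x)).congr' (this.mono fun y hy => hy.symm)

theorem exists_continuous_eqOn {K : Set ℂ} (hK : IsClosed K) {g : ℂ → ℂ} (hg : ContinuousOn g K) :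
    ∃ G : ℂ → ℂ, Continuous G ∧ EqOn G g K := by
  obtain ⟨G, hG⟩ := ContinuousMap.exists_restrict_eq hK ⟨K.domRestrict g, hg.domRestrict⟩
  exact ⟨G, G.continuous, fun z hz => congrArg (fun φ : C(K, ℂ) => φ ⟨z, hz⟩) hG⟩

/-- A nonvanishing continuous function on a compact set has a logarithm on the intersection with
a vertical line. -/
theorem HasLog.of_line {K : Set ℂ} (hK : IsCompact K) {f : ℂ → ℂ} (hf : ContinuousOn f K)
    (hf0 : ∀ z ∈ K, f z ≠ 0) (x : ℝ) : HasLog f (K ∩ {z | z.re = x}) := by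
  obtain ⟨R, hR⟩ := hK.isBounded.subset_closedBall 0
  have hR' : ∀ z ∈ K, |z.im| ≤ R := fun z hz =>
    (Complex.abs_im_le_norm z).trans (mem_closedBall_zero_iff.1 (hR hz))
  have key := interval_induction
    (P := fun a b => HasLog f (K ∩ {z | z.re = x} ∩ {z | a ≤ z.im ∧ z.im ≤ b})) ?_ ?_ ?_
    (-|R|) |R| (by linarith [abs_nonneg R])
  · refine key.mono fun z hz => ⟨hz, abs_le.1 ((hR' z hz.1).trans (le_abs_self R))⟩
  · exact fun a b c d hac hdb h => h.mono fun z hz => ⟨hz.1, hac.trans hz.2.1, hz.2.2.trans hdb⟩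
  · rintro a e b hae heb ⟨g, hg, hgf⟩ ⟨k, hk, hkf⟩
    -- The two pieces meet in at most one point, so a constant in `2πiℤ` matches them.
    have hc : ∃ c : ℂ, ∀ z ∈ K, z.re = x → z.im = e → g z = k z + c ∧ Complex.exp c = 1 := by
      refine ⟨g ⟨x, e⟩ - k ⟨x, e⟩, fun z hz h1 h2 => ?_⟩
      have : z = ⟨x, e⟩ := Complex.ext h1 h2
      subst this
      refine ⟨by ring, ?_⟩
      rw [Complex.exp_sub, hgf _ ⟨⟨hz, rfl⟩, hae, le_rfl⟩, hkf _ ⟨⟨hz, rfl⟩, le_rfl, heb⟩,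
        div_self (hf0 _ hz)]
    obtain ⟨c, hc⟩ : ∃ c : ℂ, Complex.exp c = 1 ∧
        ∀ z ∈ K, z.re = x → z.im = e → g z = k z + c := by
      obtain ⟨c, hc⟩ := hc
      by_cases hz : (⟨x, e⟩ : ℂ) ∈ K
      · exact ⟨c, (hc _ hz rfl rfl).2, fun z hz h1 h2 => (hc z hz h1 h2).1⟩
      · exact ⟨0, Complex.exp_zero, fun z hzK h1 h2 => absurd hzK (by
          rwa [show z = ⟨x, e⟩ from Complex.ext h1 h2])⟩
    refine ⟨fun z => if z.im ≤ e then g z else k z + c, ?_, ?_⟩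
    · refine ContinuousOn.of_inter_isClosed (A := {z | z.im ≤ e}) (B := {z | e ≤ z.im})
        (isClosed_le Complex.continuous_im continuous_const)
        (isClosed_le continuous_const Complex.continuous_im)
        (fun z _ => le_total z.im e) ?_ ?_
      · refine (hg.mono ?_).congr fun z hz => if_pos hz.2
        exact fun z hz => ⟨hz.1.1, hz.1.2.1, hz.2⟩
      · refine ((hk.mono ?_).add (continuousOn_const (c := c))).congr (fun z hz => ?_)
        · exact fun z hz => ⟨hz.1.1, hz.2, hz.1.2.2⟩
        · rcases (show e ≤ z.im from hz.2).lt_or_eq with h | h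
          · exact if_neg h.not_ge
          · exact (if_pos h.ge).trans (hc.2 z hz.1.1.1 hz.1.1.2 h.symm)
    · intro z hz
      dsimp only
      split_ifs with h
      · exact hgf z ⟨hz.1, hz.2.1, h⟩
      · rw [Complex.exp_add, hc.1, mul_one]
        exact hkf z ⟨hz.1, (not_le.1 h).le, hz.2.2⟩
  · intro y
    by_cases hy : (⟨x, y⟩ : ℂ) ∈ K
    · have h0 : 0 < ‖f ⟨x, y⟩‖ := norm_pos_iff.2 (hf0 _ hy)
      obtain ⟨ε, hε, h⟩ := Metric.continuousWithinAt_iff.1 (hf _ hy) _ h0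
      refine ⟨ε / 2, half_pos hε, (HasLog.const (hf0 _ hy) _).of_close
        (hf.mono fun z hz => hz.1.1) fun z hz => ?_⟩
      rw [← dist_eq_norm]
      refine h hz.1.1 ?_
      rw [Complex.dist_of_re_eq (by exact hz.1.2), Real.dist_eq, abs_lt]
      have := hz.2.1
      have := hz.2.2
      constructor <;> simp only <;> linarith
    · obtain ⟨ε, hε, h⟩ := Metric.isOpen_iff.1 hK.isClosed.isOpen_compl _ hy
      refine ⟨ε / 2, half_pos hε, 0, continuousOn_const, fun z hz => absurd hz.1.1 (h ?_)⟩
      rw [Metric.mem_ball, Complex.dist_of_re_eq (by exact hz.1.2), Real.dist_eq, abs_lt]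
      have := hz.2.1
      have := hz.2.2
      constructor <;> simp only <;> linarith

/-- If a nonvanishing continuous function on a compact set has a logarithm on a vertical line, it
has one on a vertical strip. -/
theorem HasLog.exists_strip {K : Set ℂ} (hK : IsCompact K) {f : ℂ → ℂ} (hf : ContinuousOn f K)
    {x : ℝ} (h : HasLog f (K ∩ {z | z.re = x})) :
    ∃ ε > 0, HasLog f (K ∩ {z | x - ε ≤ z.re ∧ z.re ≤ x + ε}) := by
  obtain ⟨g, hg, hgf⟩ := h
  obtain ⟨G, hG, hGg⟩ := exists_continuous_eqOn
    (hK.isClosed.inter (isClosed_eq Complex.continuous_re continuous_const)) hg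
  have hcont : ContinuousOn (fun z => ‖f z * Complex.exp (-G z) - 1‖) K :=
    ((hf.mul hG.neg.cexp.continuousOn).sub continuousOn_const).norm
  -- The points where `exp G` is too far from `f` form a compact set off the line, so their real
  -- parts stay away from `x`.
  have hbad : IsCompact (K ∩ {z | 1 ≤ ‖f z * Complex.exp (-G z) - 1‖}) := by
    refine hK.of_isClosed_subset ?_ inter_subset_left
    exact hcont.preimage_isClosed_of_isClosed hK.isClosed isClosed_Ici
  have himg := (hbad.image Complex.continuous_re).isClosed.isOpen_compl
  obtain ⟨ε, hε, hb⟩ := Metric.isOpen_iff.1 himg x (by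
    rintro ⟨z, ⟨hz, hz1⟩, hzx⟩
    rw [mem_ofPred_eq, hGg ⟨hz, hzx⟩, ← hgf z ⟨hz, hzx⟩, ← Complex.exp_add, add_neg_cancel,
      Complex.exp_zero, sub_self, norm_zero] at hz1
    linarith)
  refine ⟨ε / 2, half_pos hε, HasLog.of_close (h := fun z => Complex.exp (G z))
    ⟨G, hG.continuousOn, fun _ _ => rfl⟩ (hf.mono inter_subset_left) fun z hz => ?_⟩
  have h1 : ‖f z * Complex.exp (-G z) - 1‖ < 1 := by
    by_contra hn
    refine hb ?_ ⟨z, ⟨hz.1, not_lt.1 hn⟩, rfl⟩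
    rw [Metric.mem_ball, Real.dist_eq, abs_lt]
    have := hz.2.1
    have := hz.2.2
    constructor <;> linarith
  have h2 : f z - Complex.exp (G z) =
      (f z * Complex.exp (-G z) - 1) * Complex.exp (G z) := by
    rw [sub_mul, mul_assoc, ← Complex.exp_add, neg_add_cancel, Complex.exp_zero, mul_one, one_mul]
  rw [h2, norm_mul]
  exact mul_lt_of_lt_one_left (norm_pos_iff.2 (Complex.exp_ne_zero _)) h1

/-- On a compact plane set without holes, every nonvanishing continuous function has a continuous
logarithm. -/
theorem HasLog.of_noHole {K : Set ℂ} (hK : IsCompact K) (hN : NoHole K) {f : ℂ → ℂ}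
    (hf : ContinuousOn f K) (hf0 : ∀ z ∈ K, f z ≠ 0) : HasLog f K := by
  have hlin : ∀ p ∉ K, HasLog (fun z => z - p) K := fun p => HasLog.sub_const_of_noHole hK hN
  obtain ⟨R, hR⟩ := hK.isBounded.subset_closedBall 0
  have hR0 : ∀ z ∈ K, ‖z‖ ≤ |R| := fun z hz =>
    (mem_closedBall_zero_iff.1 (hR hz)).trans (le_abs_self R)
  have hRre : ∀ z ∈ K, -|R| ≤ z.re ∧ z.re ≤ |R| := fun z hz =>
    abs_le.1 ((Complex.abs_re_le_norm z).trans (hR0 z hz))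
  have hRim : ∀ z ∈ K, -|R| ≤ z.im ∧ z.im ≤ |R| := fun z hz =>
    abs_le.1 ((Complex.abs_im_le_norm z).trans (hR0 z hz))
  have key := interval_induction
    (P := fun a b => HasLog f (K ∩ {z | a ≤ z.re ∧ z.re ≤ b})) ?_ ?_ ?_
    (-|R|) |R| (by linarith [abs_nonneg R])
  · exact key.mono fun z hz => ⟨hz, hRre z hz⟩
  · exact fun a b c d hac hdb h => h.mono fun z hz => ⟨hz.1, hac.trans hz.2.1, hz.2.2.trans hdb⟩
  · rintro a e b hae heb ⟨g, hg, hgf⟩ ⟨k, hk, hkf⟩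
    have hcont : Continuous fun t : ℝ => (⟨e, t⟩ : ℂ) := by
      have : (fun t : ℝ => (⟨e, t⟩ : ℂ)) = fun t : ℝ => (e : ℂ) + t * Complex.I := by
        ext t
        apply Complex.ext <;> simp
      rw [this]
      fun_prop
    obtain ⟨m, hm, hmu⟩ := exists_int_continuousOn (u := fun t : ℝ => g ⟨e, t⟩ - k ⟨e, t⟩)
      (S := {t : ℝ | (⟨e, t⟩ : ℂ) ∈ K})
      ((hg.comp hcont.continuousOn fun t ht => ⟨ht, hae, le_rfl⟩).sub
        (hk.comp hcont.continuousOn fun t ht => ⟨ht, le_rfl, heb⟩)) (fun t ht => by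
          rw [Complex.exp_sub, hgf _ ⟨ht, hae, le_rfl⟩, hkf _ ⟨ht, le_rfl, heb⟩,
            div_self (hf0 _ ht)])
    obtain ⟨v, hv, hvm⟩ := exists_mem_stepSpan (hK.isClosed.preimage hcont) hm
      (show -|R| ≤ |R| by linarith [abs_nonneg R])
    obtain ⟨h₁, h₂, c₁, c₂, e₁, e₂, hd⟩ := exists_log_half_planes hlin e hv
    have hagree : ∀ z ∈ K, z.re = e → g z - h₁ z = k z - h₂ z := by
      intro z hz hre
      have hze : (⟨e, z.im⟩ : ℂ) = z := Complex.ext hre.symm rfl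
      have hmem : (⟨e, z.im⟩ : ℂ) ∈ K := by rwa [hze]
      have h1 := hd _ hz hre
      have h2 := hmu _ hmem
      rw [hvm z.im hmem (hRim _ hz).1 (hRim _ hz).2] at h1
      rw [hze] at h2
      linear_combination h2 - h1
    refine ⟨fun z => if z.re ≤ e then g z - h₁ z else k z - h₂ z, ?_, ?_⟩
    · refine ContinuousOn.of_inter_isClosed (A := {z | z.re ≤ e}) (B := {z | e ≤ z.re})
        (isClosed_le Complex.continuous_re continuous_const)
        (isClosed_le continuous_const Complex.continuous_re)
        (fun z _ => le_total z.re e) ?_ ?_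
      · refine ((hg.mono ?_).sub (c₁.mono ?_)).congr fun z hz => if_pos hz.2
        · exact fun z hz => ⟨hz.1.1, hz.1.2.1, hz.2⟩
        · exact fun z hz => ⟨hz.1.1, hz.2⟩
      · refine ((hk.mono ?_).sub (c₂.mono ?_)).congr (fun z hz => ?_)
        · exact fun z hz => ⟨hz.1.1, hz.2, hz.1.2.2⟩
        · exact fun z hz => ⟨hz.1.1, hz.2⟩
        · rcases (show e ≤ z.re from hz.2).lt_or_eq with h | h
          · exact if_neg h.not_ge
          · exact (if_pos h.ge).trans (hagree z hz.1.1 h.symm)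
    · intro z hz
      dsimp only
      split_ifs with h
      · rw [Complex.exp_sub, e₁ z hz.1 h, div_one]
        exact hgf z ⟨hz.1, hz.2.1, h⟩
      · rw [Complex.exp_sub, e₂ z hz.1 (not_le.1 h).le, div_one]
        exact hkf z ⟨hz.1, (not_le.1 h).le, hz.2.2⟩
  · exact fun x => (HasLog.of_line hK hf hf0 x).exists_strip hK hf

/-! ### Separation in one-point compactifications -/

/-- Otherwise `V` and the complement of its compact closure, which contains `∞`, would separate `S`.
-/
theorem notMem_of_isPreconnected_onePoint {X : Type*} [TopologicalSpace X] {S : Set (OnePoint X)}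
    (hS : IsPreconnected S) (hmem : OnePoint.infty ∈ S) {V : Set X} (hV : IsOpen V)
    (hc : IsCompact (closure V)) (hfr : ∀ x ∈ frontier V, (x : OnePoint X) ∉ S) {x : X}
    (hx : x ∈ V) : (x : OnePoint X) ∉ S := by
  intro hxS
  have h1 : IsOpen ((fun x : X => (x : OnePoint X)) '' V) := OnePoint.isOpen_image_coe.2 hV
  have h2 : IsOpen ((fun x : X => (x : OnePoint X)) '' closure V)ᶜ :=
    OnePoint.isOpen_compl_image_coe.2 ⟨isClosed_closure, hc⟩
  have hcov : S ⊆ (fun x : X => (x : OnePoint X)) '' V ∪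
      ((fun x : X => (x : OnePoint X)) '' closure V)ᶜ := by
    intro y hy
    by_cases hyc : y ∈ (fun x : X => (x : OnePoint X)) '' closure V
    · obtain ⟨v, hv, rfl⟩ := hyc
      refine Or.inl ⟨v, ?_, rfl⟩
      by_contra hvV
      exact hfr v (by rw [hV.frontier_eq]; exact ⟨hv, hvV⟩) hy
    · exact Or.inr hyc
  obtain ⟨y, -, ⟨v, hv, rfl⟩, hy⟩ := hS _ _ h1 h2 hcov ⟨x, hxS, x, hx, rfl⟩
    ⟨_, hmem, by simp⟩
  exact hy ⟨v, subset_closure hv, rfl⟩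

theorem notMem_of_isPreconnected_onePoint_subtype {Ω : Set ℂ} (hΩ : IsOpen Ω)
    {S : Set (OnePoint Ω)} (hS : IsPreconnected S) (hmem : OnePoint.infty ∈ S) {V : Set ℂ}
    (hV : IsOpen V) (hVb : Bornology.IsBounded V) (hVΩ : closure V ⊆ Ω)
    (hfr : ∀ z : Ω, (z : ℂ) ∈ frontier V → (z : OnePoint Ω) ∉ S) (z : Ω) (hz : (z : ℂ) ∈ V) :
    (z : OnePoint Ω) ∉ S := by
  have ho := hΩ.isOpenMap_subtype_val
  refine notMem_of_isPreconnected_onePoint hS hmem (V := Subtype.val ⁻¹' V)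
    (hV.preimage continuous_subtype_val) ?_ (fun x hx => hfr x ?_) hz
  · rw [← ho.preimage_closure_eq_closure_preimage continuous_subtype_val]
    rw [IsInducing.subtypeVal.isCompact_preimage_iff (by simpa using hVΩ)]
    exact hVb.isCompact_closure
  · rwa [← ho.preimage_frontier_eq_frontier_preimage continuous_subtype_val] at hx

/-- The only form in which simple connectedness is used: the connected complement of `Ω` contains
`∞` and avoids the frontier of `V`, so it cannot meet `V`. -/
theorem IsSimplyConnectedOpen.closure_subset {Ω : Set ℂ} (hΩ : IsSimplyConnectedOpen Ω) {V : Set ℂ}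
    (hV : IsOpen V) (hVb : Bornology.IsBounded V) (hfr : frontier V ⊆ Ω) : closure V ⊆ Ω := by
  have key : V ⊆ Ω := by
    intro z hz
    by_contra hzΩ
    refine notMem_of_isPreconnected_onePoint hΩ.2.isPreconnected (by simp) hV
      hVb.isCompact_closure (fun x hx hxΩ => hxΩ ⟨x, hfr hx, rfl⟩) hz ?_
    rintro ⟨w, hw, hwz⟩
    exact hzΩ (OnePoint.coe_injective hwz ▸ hw)
  rw [closure_eq_self_union_frontier]
  exact union_subset key hfr

theorem IsPreconnected.subset_of_disjoint_frontier {X : Type*} [TopologicalSpace X] {S V : Set X}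
    (hS : IsPreconnected S) (hV : IsOpen V) (hSV : (S ∩ V).Nonempty)
    (hd : Disjoint S (frontier V)) : S ⊆ V := by
  refine hS.subset_left_of_subset_union hV isClosed_closure.isOpen_compl
    (disjoint_compl_right.mono_left subset_closure |>.mono_right subset_rfl) (fun z hz => ?_) hSV
  by_cases hc : z ∈ closure V
  · rw [closure_eq_self_union_frontier] at hc
    exact Or.inl (hc.resolve_right fun h => hd.le_bot ⟨hz, h⟩)
  · exact Or.inr hc

/-! ### Compact exhaustion of `Ω` -/

/-- The points of norm at most `n` and of distance at least `1 / (n + 1)` from the complement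
of `Ω`. -/
def exhaust (Ω : Set ℂ) (n : ℕ) : Set ℂ :=
  {z | ‖z‖ ≤ n ∧ ∀ w ∉ Ω, 1 / ((n : ℝ) + 1) ≤ dist z w}

theorem exhaust_subset (Ω : Set ℂ) (n : ℕ) : exhaust Ω n ⊆ Ω := by
  intro z hz
  by_contra h
  have := hz.2 z h
  rw [dist_self] at this
  exact absurd this (not_le.2 (by positivity))

theorem exhaust_mono (Ω : Set ℂ) : Monotone (exhaust Ω) := by
  intro m n hmn z hz
  refine ⟨hz.1.trans (by exact_mod_cast hmn), fun w hw => le_trans ?_ (hz.2 w hw)⟩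
  gcongr

theorem isCompact_exhaust (Ω : Set ℂ) (n : ℕ) : IsCompact (exhaust Ω n) := by
  refine (isCompact_closedBall (0 : ℂ) n).of_isClosed_subset ?_
    fun z hz => mem_closedBall_zero_iff.2 hz.1
  have : exhaust Ω n = {z | ‖z‖ ≤ n} ∩ ⋂ w ∈ Ωᶜ, {z | 1 / ((n : ℝ) + 1) ≤ dist z w} := by
    ext z
    simp [exhaust]
  rw [this]
  exact (isClosed_le continuous_norm continuous_const).inter
    (isClosed_biInter fun w _ => isClosed_le continuous_const (by fun_prop))

theorem exists_exhaust_mem_nhds {Ω : Set ℂ} (hΩ : IsOpen Ω) {z : ℂ} (hz : z ∈ Ω) :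
    ∃ n, exhaust Ω n ∈ 𝓝 z := by
  obtain ⟨r, hr, hb⟩ := Metric.isOpen_iff.1 hΩ z hz
  obtain ⟨n, hn⟩ := exists_nat_gt (max (‖z‖ + r) (2 / r))
  have hn1 : ‖z‖ + r < n := (le_max_left _ _).trans_lt hn
  have hn2 : 2 / r < n := (le_max_right _ _).trans_lt hn
  refine ⟨n, Filter.mem_of_superset (Metric.ball_mem_nhds z (half_pos hr)) fun y hy => ⟨?_, ?_⟩⟩
  · rw [mem_ball_iff_norm] at hy
    have := norm_le_insert' y z
    linarith
  · intro w hw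
    have hw' : r ≤ dist w z := not_lt.1 fun h => hw (hb h)
    have h1 : r / 2 ≤ dist y w := by
      have := dist_triangle w y z
      rw [Metric.mem_ball] at hy
      rw [dist_comm w y] at this
      linarith
    refine le_trans ?_ h1
    rw [div_le_iff₀ (by positivity)]
    rw [div_lt_iff₀ hr] at hn2
    nlinarith

theorem exists_subset_exhaust {Ω : Set ℂ} (hΩ : IsOpen Ω) {K : Set ℂ} (hK : IsCompact K)
    (hKΩ : K ⊆ Ω) : ∃ n, K ⊆ exhaust Ω n := by
  obtain ⟨n, hn⟩ := hK.elim_directed_cover (fun n => interior (exhaust Ω n))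
    (fun _ => isOpen_interior) (fun z hz => by
      obtain ⟨n, hn⟩ := exists_exhaust_mem_nhds hΩ (hKΩ hz)
      exact mem_iUnion.2 ⟨n, mem_interior_iff_mem_nhds.2 hn⟩)
    (Monotone.directed_le fun m n hmn => interior_mono (exhaust_mono Ω hmn))
  exact ⟨n, hn.trans interior_subset⟩

/-- A segment leaving `V` crosses its frontier. Radial segments give the norm bound, and segments to
points off `Ω` give the distance bound. -/
theorem subset_exhaust_of_frontier {Ω : Set ℂ} (hΩ : IsSimplyConnectedOpen Ω) {V : Set ℂ}
    (hV : IsOpen V) (hVb : Bornology.IsBounded V) {n : ℕ} (hfr : frontier V ⊆ exhaust Ω n) :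
    V ⊆ exhaust Ω n := by
  have hVΩ := hΩ.closure_subset hV hVb (hfr.trans (exhaust_subset Ω n))
  have seg : ∀ z ∈ V, ∀ w ∉ V, ∃ y ∈ segment ℝ z w, y ∈ exhaust Ω n := by
    intro z hz w hw
    by_contra! h
    refine hw ((convex_segment z w).isPreconnected.subset_of_disjoint_frontier hV
      ⟨z, left_mem_segment ℝ z w, hz⟩ ?_ (right_mem_segment ℝ z w))
    exact disjoint_left.2 fun y hy hyf => h y hy (hfr hyf)
  intro z hz
  refine ⟨?_, fun w hw => ?_⟩
  · obtain ⟨R, hR⟩ := hVb.subset_closedBall 0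
    have hR0 : 0 ≤ R := (norm_nonneg z).trans (mem_closedBall_zero_iff.1 (hR hz))
    rcases eq_or_ne z 0 with rfl | hz0
    · simp
    have hzn : 0 < ‖z‖ := norm_pos_iff.2 hz0
    -- This point has norm `‖z‖ + R + 1`, beyond the bound `R` on `V`.
    have hw : (1 + (R + 1) / ‖z‖ : ℝ) • z ∉ V := fun h => by
      have := mem_closedBall_zero_iff.1 (hR h)
      rw [norm_smul, Real.norm_of_nonneg (by positivity), add_mul, one_mul,
        div_mul_cancel₀ _ hzn.ne'] at this
      linarith
    obtain ⟨y, hy, hyn⟩ := seg z hz _ hw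
    refine le_trans ?_ hyn.1
    obtain ⟨t, ht, rfl⟩ := (segment_eq_image' ℝ z _ ▸ hy)
    have : z + t • ((1 + (R + 1) / ‖z‖ : ℝ) • z - z) = (1 + t * ((R + 1) / ‖z‖) : ℝ) • z := by
      module
    simp only [this]
    have ht0 := ht.1
    rw [norm_smul, Real.norm_of_nonneg (by positivity)]
    refine le_mul_of_one_le_left hzn.le ?_
    have : 0 ≤ t * ((R + 1) / ‖z‖) := by positivity
    linarith
  · obtain ⟨y, hy, hyn⟩ := seg z hz w fun h => hw (hVΩ (subset_closure h))
    refine (hyn.2 w hw).trans ?_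
    have := dist_add_dist_of_mem_segment hy
    linarith [dist_nonneg (x := z) (y := y)]

/-! ### Holes and their filling -/

/-- The union of the holes of `T`. -/
def holes (T : Set ℂ) : Set ℂ :=
  ⋃₀ {V | IsOpen V ∧ Bornology.IsBounded V ∧ frontier V ⊆ T ∧ Disjoint V T}

theorem isOpen_holes (T : Set ℂ) : IsOpen (holes T) := isOpen_sUnion fun _ hV => hV.1

theorem disjoint_holes (T : Set ℂ) : Disjoint (holes T) T :=
  disjoint_sUnion_left.2 fun _ hV => hV.2.2.2

theorem subset_holes {T V : Set ℂ} (hV : IsOpen V) (hVb : Bornology.IsBounded V)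
    (hfr : frontier V ⊆ T) (hd : Disjoint V T) : V ⊆ holes T :=
  subset_sUnion_of_mem ⟨hV, hVb, hfr, hd⟩

/-- A frontier point off `T` has a ball that misses `T`. This ball meets some hole, cannot cross its
frontier, and so lies inside it. -/
theorem frontier_holes_subset {Ω T : Set ℂ} (hT : closure T ∩ Ω ⊆ T)
    (hH : closure (holes T) ⊆ Ω) : frontier (holes T) ⊆ T := by
  intro z hz
  by_contra hzT
  have hzc : z ∉ closure T := fun h => hzT (hT ⟨h, hH hz.1⟩)
  obtain ⟨r, hr, hb⟩ := Metric.isOpen_iff.1 isClosed_closure.isOpen_compl z hzc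
  obtain ⟨y, ⟨V, hV, hyV⟩, hd⟩ := Metric.mem_closure_iff.1 hz.1 r hr
  have hsub : Metric.ball z r ⊆ V :=
    (convex_ball z r).isPreconnected.subset_of_disjoint_frontier hV.1
      ⟨y, by rwa [Metric.mem_ball, dist_comm], hyV⟩
      (disjoint_left.2 fun w hw hwf => hb hw (subset_closure (hV.2.2.1 hwf)))
  rw [(isOpen_holes T).frontier_eq] at hz
  exact hz.2 ⟨V, hV, hsub (Metric.mem_ball_self hr)⟩

/-- A hole of the filled set, united with `holes T`, would satisfy the conditions for a hole of `T`,
so it would lie in `holes T`, from which it is disjoint. -/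
theorem noHole_union_holes {T : Set ℂ} (hfr : frontier (holes T) ⊆ T)
    (hb : Bornology.IsBounded (holes T)) : NoHole (T ∪ holes T) := by
  intro V hV hVb hVf hVd
  have hVH : Disjoint V (holes T) := hVd.mono_right subset_union_right
  have hsub : V ∪ holes T ⊆ holes T := by
    refine subset_holes (hV.union (isOpen_holes T)) (hVb.union hb) (fun z hz => ?_)
      (disjoint_union_left.2 ⟨hVd.mono_right subset_union_left, disjoint_holes T⟩)
    have hzn := (hV.union (isOpen_holes T)).frontier_eq ▸ hz
    rcases frontier_union_subset _ _ hz with h | h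
    · exact (hVf h.1).resolve_right fun hH => hzn.2 (Or.inr hH)
    · exact hfr h.2
  exact disjoint_self.1 (hVH.mono_right (subset_union_left.trans hsub))

/-! ### Holes of Arakelian sets -/

theorem onePoint_coe_notMem_onePointDiff {Ω F : Set ℂ} {z : Ω} :
    (z : OnePoint Ω) ∉ onePointDiff Ω F ↔ (z : ℂ) ∈ F := by
  rw [onePointDiff, notMem_compl_iff]
  refine ⟨?_, fun h => ⟨z, h, rfl⟩⟩
  rintro ⟨w, hw, hwz⟩
  exact OnePoint.coe_injective hwz ▸ hw

theorem infty_mem_onePointDiff (Ω F : Set ℂ) : OnePoint.infty ∈ onePointDiff Ω F := by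
  simp [onePointDiff]

/-- Condition (i) at work: the closure of a hole is a compact subset of `Ω`, so the hole would be
cut off from `α` in the complement of `F`. -/
theorem IsArakelian.noHole {Ω F : Set ℂ} (hF : IsArakelian Ω F) (hΩ : IsSimplyConnectedOpen Ω) :
    NoHole F := by
  intro V hV hVb hfr hd
  have hVΩ := hΩ.closure_subset hV hVb (hfr.trans hF.subset)
  refine eq_empty_of_forall_notMem fun z hz => hd.le_bot ⟨hz, ?_⟩
  exact onePoint_coe_notMem_onePointDiff.1 <|
    notMem_of_isPreconnected_onePoint_subtype hΩ.1 hF.isConnected.isPreconnected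
      (infty_mem_onePointDiff Ω F) hV hVb hVΩ
      (fun z hz => onePoint_coe_notMem_onePointDiff.2 (hfr hz))
      ⟨z, hVΩ (subset_closure hz)⟩ hz

theorem IsArakelian.closure_inter_subset {Ω F : Set ℂ} (hF : IsArakelian Ω F) :
    closure F ∩ Ω ⊆ F := by
  rintro z ⟨hz, hzΩ⟩
  have : (⟨z, hzΩ⟩ : Ω) ∈ closure {z : Ω | (z : ℂ) ∈ F} := by
    rw [closure_subtype]
    convert hz
    ext w
    exact ⟨by rintro ⟨x, hx, rfl⟩; exact hx, fun hw => ⟨⟨w, hF.subset hw⟩, hw, rfl⟩⟩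
  rwa [hF.isClosed.closure_eq] at this

/-- The holes of `F ∪ K` stay in a compact subset of `Ω`. -/
theorem IsArakelian.exists_holes_subset {Ω F : Set ℂ} (hF : IsArakelian Ω F)
    (hΩ : IsSimplyConnectedOpen Ω) {K : Set ℂ} (hK : IsCompact K) (hKΩ : K ⊆ Ω) :
    ∃ L, IsCompact L ∧ L ⊆ Ω ∧ holes (F ∪ K) ⊆ L := by
  have hKc : IsCompact (Subtype.val ⁻¹' K : Set Ω) := by
    rw [IsInducing.subtypeVal.isCompact_preimage_iff (by simpa using hKΩ)]
    exact hK
  have hU : ((fun z : Ω => (z : OnePoint Ω)) '' (Subtype.val ⁻¹' K))ᶜ ∈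
      𝓝 (OnePoint.infty : OnePoint Ω) :=
    (OnePoint.isOpen_compl_image_coe.2 ⟨hKc.isClosed, hKc⟩).mem_nhds (by simp)
  -- By (ii), `W \ F` is connected, contains `α` and avoids `F ∪ K`, hence the frontier of every
  -- hole; so no hole meets it. The complement of the interior of `W` is the required compact set.
  obtain ⟨W, hW, hWU, hWc⟩ := hF.isLocallyConnectedAt _ hU
  have hWi : IsCompact ((fun z : Ω => (z : OnePoint Ω)) ⁻¹' interior W)ᶜ :=
    ((OnePoint.isOpen_iff_of_mem (mem_interior_iff_mem_nhds.2 hW)).1 isOpen_interior).2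
  refine ⟨Subtype.val '' ((fun z : Ω => (z : OnePoint Ω)) ⁻¹' interior W)ᶜ,
    hWi.image continuous_subtype_val, by rintro _ ⟨z, -, rfl⟩; exact z.2, ?_⟩
  refine sUnion_subset ?_
  rintro V ⟨hV, hVb, hfr, hd⟩ z hz
  have hVΩ := hΩ.closure_subset hV hVb (hfr.trans (union_subset hF.subset hKΩ))
  have hzΩ := hVΩ (subset_closure hz)
  refine ⟨⟨z, hzΩ⟩, fun hzW => ?_, rfl⟩
  have := notMem_of_isPreconnected_onePoint_subtype hΩ.1 hWc.isPreconnected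
    ⟨mem_of_mem_nhds hW, infty_mem_onePointDiff Ω F⟩ hV hVb hVΩ (fun y hy hyS => ?_) ⟨z, hzΩ⟩ hz
  · refine this ⟨interior_subset hzW, ?_⟩
    by_contra h
    exact hd.le_bot ⟨hz, Or.inl (onePoint_coe_notMem_onePointDiff.1 h)⟩
  · rcases hfr hy with h | h
    · exact onePoint_coe_notMem_onePointDiff.2 h hyS.2
    · exact hWU hyS.1 ⟨y, h, rfl⟩

/-! ### Zero-free continuous extension -/

/-- A large exhaustion member contains `E` and cuts `T` in a compact set without holes. A logarithm
of `φ` there, extended by Tietze and exponentiated, supplies the values on `E \ T`. -/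
theorem NoHole.exists_extension {Ω T E : Set ℂ} (hΩ : IsSimplyConnectedOpen Ω) (hN : NoHole T)
    (hTΩ : T ⊆ Ω) (hT : closure T ∩ Ω ⊆ T) (hE : IsCompact E) (hEΩ : E ⊆ Ω) {φ : ℂ → ℂ}
    (hφ : ContinuousOn φ T) (hφ0 : ∀ z ∈ T, φ z ≠ 0) :
    ∃ ψ : ℂ → ℂ, ContinuousOn ψ (T ∪ E) ∧ (∀ z ∈ T ∪ E, ψ z ≠ 0) ∧ EqOn φ ψ T := by
  obtain ⟨n, hn⟩ := exists_subset_exhaust hΩ.1 hE hEΩ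
  have hC : IsCompact (T ∩ exhaust Ω n) := by
    have : T ∩ exhaust Ω n = closure T ∩ exhaust Ω n :=
      subset_antisymm (inter_subset_inter_left _ subset_closure)
        fun z hz => ⟨hT ⟨hz.1, exhaust_subset Ω n hz.2⟩, hz.2⟩
    rw [this]
    exact (isCompact_exhaust Ω n).inter_left isClosed_closure
  -- A hole of the intersection lies in `exhaust Ω n`, so it avoids all of `T` and is a hole of `T`.
  have hCN : NoHole (T ∩ exhaust Ω n) := by
    intro V hV hVb hfr hd
    have hVn := subset_exhaust_of_frontier hΩ hV hVb (hfr.trans inter_subset_right)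
    exact hN V hV hVb (hfr.trans inter_subset_left)
      (disjoint_left.2 fun z hz hzT => hd.le_bot ⟨hz, hzT, hVn hz⟩)
  obtain ⟨g, hg, hgφ⟩ := HasLog.of_noHole hC hCN (hφ.mono inter_subset_left)
    fun z hz => hφ0 z hz.1
  obtain ⟨G, hG, hGg⟩ := exists_continuous_eqOn hC.isClosed hg
  classical
  refine ⟨fun z => if z ∈ T then φ z else Complex.exp (G z), ?_, fun z _ => ?_,
    fun z hz => (if_pos hz).symm⟩
  · refine ContinuousOn.of_inter_isClosed isClosed_closure hE.isClosed
      (union_subset_union_left E subset_closure) ?_ ?_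
    · have hsub : (T ∪ E) ∩ closure T ⊆ T := fun z hz => hT ⟨hz.2, union_subset hTΩ hEΩ hz.1⟩
      exact (hφ.mono hsub).congr fun z hz => if_pos (hsub hz)
    · refine hG.cexp.continuousOn.congr fun z hz => ?_
      by_cases hzT : z ∈ T
      · have hzC : z ∈ T ∩ exhaust Ω n := ⟨hzT, hn hz.2⟩
        exact (if_pos hzT).trans (by simp only [hGg hzC, hgφ z hzC])
      · exact if_neg hzT
  · dsimp only
    split_ifs with h
    · exact hφ0 z h
    · exact Complex.exp_ne_zero _

/-- The union of `F`, the `n`-th member of the exhaustion of `Ω` and the holes of their union. -/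
def filled (Ω F : Set ℂ) (n : ℕ) : Set ℂ :=
  F ∪ exhaust Ω n ∪ holes (F ∪ exhaust Ω n)

section filled

variable {Ω F : Set ℂ}

theorem IsArakelian.closure_holes_subset (hF : IsArakelian Ω F) (hΩ : IsSimplyConnectedOpen Ω)
    (n : ℕ) : IsCompact (closure (holes (F ∪ exhaust Ω n))) ∧
      closure (holes (F ∪ exhaust Ω n)) ⊆ Ω := by
  obtain ⟨L, hL, hLΩ, hH⟩ :=
    hF.exists_holes_subset hΩ (isCompact_exhaust Ω n) (exhaust_subset Ω n)
  have := closure_minimal hH hL.isClosed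
  exact ⟨hL.of_isClosed_subset isClosed_closure this, this.trans hLΩ⟩

theorem IsArakelian.closure_union_exhaust (hF : IsArakelian Ω F) (n : ℕ) :
    closure (F ∪ exhaust Ω n) ∩ Ω ⊆ F ∪ exhaust Ω n := by
  rw [closure_union, (isCompact_exhaust Ω n).isClosed.closure_eq, union_inter_distrib_right]
  exact union_subset_union hF.closure_inter_subset inter_subset_left

theorem IsArakelian.frontier_holes_subset (hF : IsArakelian Ω F) (hΩ : IsSimplyConnectedOpen Ω)
    (n : ℕ) : frontier (holes (F ∪ exhaust Ω n)) ⊆ F ∪ exhaust Ω n :=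
  _root_.frontier_holes_subset (hF.closure_union_exhaust n) (hF.closure_holes_subset hΩ n).2

theorem IsArakelian.noHole_filled (hF : IsArakelian Ω F) (hΩ : IsSimplyConnectedOpen Ω) (n : ℕ) :
    NoHole (filled Ω F n) :=
  noHole_union_holes (hF.frontier_holes_subset hΩ n)
    ((hF.closure_holes_subset hΩ n).1.isBounded.subset subset_closure)

theorem IsArakelian.filled_subset (hF : IsArakelian Ω F) (hΩ : IsSimplyConnectedOpen Ω) (n : ℕ) :
    filled Ω F n ⊆ Ω :=
  union_subset (union_subset hF.subset (exhaust_subset Ω n))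
    (subset_closure.trans (hF.closure_holes_subset hΩ n).2)

theorem IsArakelian.closure_filled (hF : IsArakelian Ω F) (hΩ : IsSimplyConnectedOpen Ω) (n : ℕ) :
    closure (filled Ω F n) ∩ Ω ⊆ filled Ω F n := by
  rintro z ⟨hz, hzΩ⟩
  rw [filled, closure_union] at hz
  rcases hz with h | h
  · exact Or.inl (hF.closure_union_exhaust n ⟨h, hzΩ⟩)
  · rw [closure_eq_self_union_frontier] at h
    exact h.elim Or.inr fun h => Or.inl (hF.frontier_holes_subset hΩ n h)

theorem exhaust_subset_filled (Ω F : Set ℂ) (n : ℕ) : exhaust Ω n ⊆ filled Ω F n :=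
  subset_union_right.trans subset_union_left

theorem subset_filled (Ω F : Set ℂ) (n : ℕ) : F ⊆ filled Ω F n :=
  subset_union_left.trans subset_union_left

theorem IsArakelian.filled_mono (hF : IsArakelian Ω F) (hΩ : IsSimplyConnectedOpen Ω) :
    Monotone (filled Ω F) := by
  intro m n hmn
  have hsub : F ∪ exhaust Ω m ⊆ F ∪ exhaust Ω n := union_subset_union_right F (exhaust_mono Ω hmn)
  refine union_subset (hsub.trans subset_union_left) ?_
  -- `F` need not be closed in `ℂ`, but the holes avoid it already. Only a compact set is removed,
  -- so the difference is open; it will be a hole of the larger union.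
  have hopen : holes (F ∪ exhaust Ω m) \ (F ∪ exhaust Ω n) =
      holes (F ∪ exhaust Ω m) ∩ (exhaust Ω n)ᶜ := by
    ext z
    have := fun h : z ∈ holes (F ∪ exhaust Ω m) => disjoint_left.1 (disjoint_holes _) h
    simp only [mem_sdiff, mem_union, mem_inter_iff, mem_compl_iff] at this ⊢
    tauto
  have hcl := (isCompact_exhaust Ω n).isClosed
  have key : holes (F ∪ exhaust Ω m) \ (F ∪ exhaust Ω n) ⊆ holes (F ∪ exhaust Ω n) := by
    refine subset_holes ?_ ?_ ?_ disjoint_sdiff_left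
    · rw [hopen]
      exact (isOpen_holes _).inter hcl.isOpen_compl
    · exact ((hF.closure_holes_subset hΩ m).1.isBounded.subset subset_closure).subset sdiff_subset
    · rw [hopen]
      refine (frontier_inter_subset _ _).trans (union_subset ?_ ?_)
      · exact (inter_subset_left.trans (hF.frontier_holes_subset hΩ m)).trans hsub
      · rw [frontier_compl]
        exact inter_subset_right.trans (hcl.frontier_subset.trans subset_union_right)
  intro z hz
  by_cases h : z ∈ F ∪ exhaust Ω n
  · exact Or.inl h
  · exact Or.inr (key ⟨hz, h⟩)

theorem NoHole.exists_extension_filled (hF : IsArakelian Ω F) (hΩ : IsSimplyConnectedOpen Ω)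
    {T : Set ℂ} (hN : NoHole T) (hTΩ : T ⊆ Ω) (hT : closure T ∩ Ω ⊆ T) (hFT : F ⊆ T) (n : ℕ)
    {φ : ℂ → ℂ} (hφ : ContinuousOn φ T) (hφ0 : ∀ z ∈ T, φ z ≠ 0) :
    ∃ ψ : ℂ → ℂ, (ContinuousOn ψ (filled Ω F n) ∧ ∀ z ∈ filled Ω F n, ψ z ≠ 0) ∧ EqOn φ ψ T := by
  have hH := hF.closure_holes_subset hΩ n
  obtain ⟨ψ, hψ, hψ0, he⟩ := hN.exists_extension hΩ hTΩ hT
    ((isCompact_exhaust Ω n).union hH.1) (union_subset (exhaust_subset Ω n) hH.2) hφ hφ0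
  have hsub : filled Ω F n ⊆ T ∪ (exhaust Ω n ∪ closure (holes (F ∪ exhaust Ω n))) := by
    rw [← union_assoc]
    exact union_subset_union (union_subset_union_left _ hFT) subset_closure
  exact ⟨ψ, ⟨hψ.mono hsub, fun z hz => hψ0 z (hsub hz)⟩, he⟩

/-- A nonvanishing continuous function on an Arakelian set extends to a nonvanishing continuous
function on `Ω`. -/
theorem IsArakelian.exists_extension (hF : IsArakelian Ω F) (hΩ : IsSimplyConnectedOpen Ω)
    {f : ℂ → ℂ} (hf : ContinuousOn f F) (hf0 : ∀ z ∈ F, f z ≠ 0) :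
    ∃ φ : ℂ → ℂ, ContinuousOn φ Ω ∧ (∀ z ∈ Ω, φ z ≠ 0) ∧ EqOn f φ F := by
  obtain ⟨φ₀, h₀, he₀⟩ := (hF.noHole hΩ).exists_extension_filled hF hΩ hF.subset
    hF.closure_inter_subset subset_rfl 0 hf hf0
  have hstep : ∀ (n : ℕ)
      (φ : {φ : ℂ → ℂ // ContinuousOn φ (filled Ω F n) ∧ ∀ z ∈ filled Ω F n, φ z ≠ 0}),
      ∃ ψ : {φ : ℂ → ℂ // ContinuousOn φ (filled Ω F (n + 1)) ∧
        ∀ z ∈ filled Ω F (n + 1), φ z ≠ 0}, EqOn φ.1 ψ.1 (filled Ω F n) := by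
    rintro n ⟨φ, hφ, hφ0⟩
    obtain ⟨ψ, hψ, he⟩ := (hF.noHole_filled hΩ n).exists_extension_filled hF hΩ
      (hF.filled_subset hΩ n) (hF.closure_filled hΩ n) (subset_filled Ω F n) (n + 1) hφ hφ0
    exact ⟨⟨ψ, hψ⟩, he⟩
  choose next hnext using hstep
  let Φ : ∀ n, {φ : ℂ → ℂ // ContinuousOn φ (filled Ω F n) ∧ ∀ z ∈ filled Ω F n, φ z ≠ 0} :=
    fun n => Nat.rec ⟨φ₀, h₀⟩ next n
  have hmono := hF.filled_mono hΩ
  have hΦ : ∀ m n, m ≤ n → EqOn (Φ m).1 (Φ n).1 (filled Ω F m) := by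
    intro m n hmn
    induction n, hmn using Nat.le_induction with
    | base => exact fun _ _ => rfl
    | succ n hmn ih => exact ih.trans ((hnext n (Φ n)).mono (hmono hmn))
  have hmem : ∀ z ∈ Ω, ∃ n, z ∈ filled Ω F n := fun z hz =>
    (exists_exhaust_mem_nhds hΩ.1 hz).imp fun n hn =>
      exhaust_subset_filled Ω F n (mem_of_mem_nhds hn)
  choose! N hN using hmem
  have hagree : ∀ n, EqOn (fun z => (Φ (N z)).1 z) (Φ n).1 (filled Ω F n) := by
    intro n z hz
    have hzN := hN z (hF.filled_subset hΩ n hz)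
    rcases le_total (N z) n with h | h
    · exact hΦ _ _ h hzN
    · exact (hΦ _ _ h hz).symm
  refine ⟨fun z => (Φ (N z)).1 z, fun z hz => ?_, fun z hz => (Φ (N z)).2.2 z (hN z hz), ?_⟩
  · obtain ⟨n, hn⟩ := exists_exhaust_mem_nhds hΩ.1 hz
    have hn' := Filter.mem_of_superset hn (exhaust_subset_filled Ω F n)
    exact (((Φ n).2.1.congr (hagree n)).continuousAt hn').continuousWithinAt
  · exact fun z hz => (he₀ hz).trans (hagree 0 (subset_filled Ω F 0 hz)).symm

end filled

/-! ### Gluing logarithms over the exhaustion -/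

theorem sub_eq_sub_of_isPreconnected {S : Set ℂ} (hS : IsPreconnected S) {u v : ℂ → ℂ}
    (hu : ContinuousOn u S) (hv : ContinuousOn v S)
    (h : ∀ z ∈ S, Complex.exp (u z) = Complex.exp (v z)) {z w : ℂ} (hz : z ∈ S) (hw : w ∈ S) :
    u z - u w = v z - v w := by
  obtain ⟨m, hm, hmu⟩ := exists_int_continuousOn (hu.sub hv) fun z hz => by
    rw [Pi.sub_apply, Complex.exp_sub, h z hz, div_self (Complex.exp_ne_zero _)]
  have h1 := hmu z hz
  have h2 := hmu w hw
  rw [hS.constant hm hz hw] at h1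
  simp only [Pi.sub_apply] at h1 h2
  linear_combination h1 - h2

/-- A nonvanishing function on an open set `Ω` with a logarithm on each member of the exhaustion
has a logarithm on `Ω`. -/
theorem HasLog.of_exhaust {Ω : Set ℂ} (hΩ : IsOpen Ω) {φ : ℂ → ℂ} (hφ0 : ∀ z ∈ Ω, φ z ≠ 0)
    (h : ∀ n, HasLog φ (exhaust Ω n)) : HasLog φ Ω := by
  choose l hl hlφ using h
  -- The base point depends only on the component as a set, so all points of a component share it.
  have hbase : ∃ β : Set ℂ → ℂ, ∀ C : Set ℂ, C.Nonempty → β C ∈ C := by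
    choose! β hβ using fun (C : Set ℂ) (hC : C.Nonempty) => (hC : ∃ z, z ∈ C)
    exact ⟨β, hβ⟩
  obtain ⟨β, hβ⟩ := hbase
  let b : ℂ → ℂ := fun z => β (connectedComponentIn Ω z)
  have hb : ∀ z ∈ Ω, b z ∈ connectedComponentIn Ω z := fun z hz =>
    hβ _ ⟨z, mem_connectedComponentIn hz⟩
  have hbΩ : ∀ z ∈ Ω, b z ∈ Ω := fun z hz => connectedComponentIn_subset Ω z (hb z hz)
  -- Once `w` and `z` are joined inside `exhaust Ω n`, the increment `l n z - l n w` no longer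
  -- changes with larger `n`.
  let R : ℕ → ℂ → ℂ → Prop := fun n w z =>
    ∃ S ⊆ exhaust Ω n, IsPreconnected S ∧ w ∈ S ∧ z ∈ S
  have hR : ∀ z ∈ Ω, ∃ n, R n (b z) z := by
    intro z hz
    have hpc : IsPathConnected (connectedComponentIn Ω z) :=
      hΩ.connectedComponentIn.isConnected_iff_isPathConnected.1
        (isConnected_connectedComponentIn_iff.2 hz)
    obtain ⟨γ, hγ⟩ := hpc.joinedIn _ (hb z hz) _ (mem_connectedComponentIn hz)
    obtain ⟨n, hn⟩ := exists_subset_exhaust hΩ (isCompact_range γ.continuous)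
      (range_subset_iff.2 fun t => connectedComponentIn_subset Ω z (hγ t))
    exact ⟨n, range γ, hn, isPreconnected_range γ.continuous, ⟨0, γ.source⟩, ⟨1, γ.target⟩⟩
  have hRmono : ∀ {m n : ℕ} {w z : ℂ}, m ≤ n → R m w z → R n w z :=
    fun hmn ⟨S, hS, h⟩ => ⟨S, hS.trans (exhaust_mono Ω hmn), h⟩
  have hRl : ∀ {m n : ℕ} {w z : ℂ}, m ≤ n → R m w z → l m z - l m w = l n z - l n w := by
    rintro m n w z hmn ⟨S, hS, hSc, hw, hz⟩
    have hSn := hS.trans (exhaust_mono Ω hmn)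
    exact sub_eq_sub_of_isPreconnected hSc ((hl m).mono hS) ((hl n).mono hSn)
      (fun y hy => (hlφ m y (hS hy)).trans (hlφ n y (hSn hy)).symm) hz hw
  choose! N hN using hR
  have hgN : ∀ z ∈ Ω, ∀ n, R n (b z) z → l (N z) z - l (N z) (b z) = l n z - l n (b z) := by
    intro z hz n hn
    exact (hRl (le_max_left _ n) (hN z hz)).trans (hRl (le_max_right (N z) _) hn).symm
  refine ⟨fun z => l (N z) z - l (N z) (b z) + Complex.log (φ (b z)), fun z hz => ?_,
    fun z hz => ?_⟩
  · obtain ⟨k, hk⟩ := exists_exhaust_mem_nhds hΩ hz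
    obtain ⟨r, hr, hball⟩ := Metric.mem_nhds_iff.1 hk
    set M := max k (N z) with hM
    have hballM : Metric.ball z r ⊆ exhaust Ω M :=
      hball.trans (exhaust_mono Ω (le_max_left _ _))
    have hpre : IsPreconnected (Metric.ball z r) := (convex_ball z r).isPreconnected
    have hzb := Metric.mem_ball_self hr (x := z)
    have heq : ∀ w ∈ Metric.ball z r, l (N w) w - l (N w) (b w) + Complex.log (φ (b w)) =
        l M w - l M (b z) + Complex.log (φ (b z)) := by
      intro w hw
      have hwΩ := exhaust_subset Ω M (hballM hw)
      have hbw : b w = b z := congrArg β (connectedComponentIn_eq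
        (hpre.subset_connectedComponentIn hzb (hballM.trans (exhaust_subset Ω M)) hw)).symm
      obtain ⟨S, hS, hSc, hbS, hzS⟩ := hRmono (le_max_right k (N z)) (hN z hz)
      have hRw : R M (b w) w := by
        rw [hbw]
        exact ⟨S ∪ Metric.ball z r, union_subset hS hballM,
          hSc.union z hzS hzb hpre, Or.inl hbS, Or.inr hw⟩
      rw [hgN w hwΩ M hRw, hbw]
    have hMz : exhaust Ω M ∈ 𝓝 z := Filter.mem_of_superset hk (exhaust_mono Ω (le_max_left _ _))
    have hc : ContinuousAt (fun w => l M w - l M (b z) + Complex.log (φ (b z))) z :=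
      (((hl M).continuousAt hMz).sub continuousAt_const).add continuousAt_const
    exact (hc.congr (Filter.eventuallyEq_of_mem (Metric.ball_mem_nhds z hr)
      heq).symm).continuousWithinAt
  · obtain ⟨S, hS, -, hbS, hzS⟩ := hN z hz
    rw [Complex.exp_add, Complex.exp_sub, hlφ _ _ (hS hzS), hlφ _ _ (hS hbS),
      Complex.exp_log (hφ0 _ (hbΩ z hz)), div_mul_cancel₀ _ (hφ0 _ (hbΩ z hz))]

theorem noHole_exhaust {Ω : Set ℂ} (hΩ : IsSimplyConnectedOpen Ω) (n : ℕ) :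
    NoHole (exhaust Ω n) := by
  intro V hV hVb hfr hd
  exact disjoint_self.1 (hd.mono_right (subset_exhaust_of_frontier hΩ hV hVb hfr))

/-! ### Holomorphy and conclusion -/

/-- A continuous logarithm of a holomorphic function is holomorphic. -/
theorem differentiableOn_of_exp_eq {U : Set ℂ} (hU : IsOpen U) {f g : ℂ → ℂ}
    (hf : DifferentiableOn ℂ f U) (hg : ContinuousOn g U)
    (hgf : ∀ z ∈ U, f z = Complex.exp (g z)) : DifferentiableOn ℂ g U := by
  intro z hz
  have hzU := hU.mem_nhds hz
  have hquot : ∀ w ∈ U, f w / f z = Complex.exp (g w - g z) := fun w hw => by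
    rw [hgf w hw, hgf z hz, Complex.exp_sub]
  -- Near `z` the imaginary part of `g w - g z` is below 1 in absolute value, hence below `π`, so
  -- the principal logarithm inverts the exponential.
  have hev : g =ᶠ[𝓝 z] fun w => Complex.log (f w / f z) + g z := by
    have hd := Metric.tendsto_nhds.1 (hg.continuousAt hzU) 1 one_pos
    filter_upwards [hd, hzU] with w hw hwU
    rw [dist_eq_norm] at hw
    have him := abs_lt.1 ((Complex.abs_im_le_norm _).trans_lt hw)
    rw [hquot w hwU, Complex.log_exp (by linarith [him.1, Real.pi_gt_three])
      (by linarith [him.2, Real.pi_gt_three]), sub_add_cancel]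
  have hfz : f z ≠ 0 := hgf z hz ▸ Complex.exp_ne_zero _
  have hd : DifferentiableAt ℂ (fun w => Complex.log (f w / f z) + g z) z := by
    refine (DifferentiableAt.clog ((hf.differentiableAt hzU).div_const _) ?_).add_const _
    rw [div_self hfz]
    exact Complex.one_mem_slitPlane
  exact (hd.congr_of_eventuallyEq hev).differentiableWithinAt

theorem corollary2p12 (Ω F : Set ℂ) (hΩ : IsSimplyConnectedOpen Ω) (hF : IsArakelian Ω F)
    (f : ℂ → ℂ) (hf : f ∈ spaceA F) (hf0 : ∀ z ∈ F, f z ≠ 0) :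
    ∃ g ∈ spaceA F, ∀ z ∈ F, f z = Complex.exp (g z) := by
  obtain ⟨φ, hφ, hφ0, he⟩ := hF.exists_extension hΩ hf.1 hf0
  obtain ⟨g, hg, hgφ⟩ := HasLog.of_exhaust hΩ.1 hφ0 fun n =>
    HasLog.of_noHole (isCompact_exhaust Ω n) (noHole_exhaust hΩ n)
      (hφ.mono (exhaust_subset Ω n)) fun z hz => hφ0 z (exhaust_subset Ω n hz)
  have hgf : ∀ z ∈ F, f z = Complex.exp (g z) := fun z hz =>
    (he hz).trans (hgφ z (hF.subset hz)).symm
  refine ⟨g, ⟨hg.mono hF.subset, ?_⟩, hgf⟩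
  exact differentiableOn_of_exp_eq isOpen_interior hf.2
    (hg.mono (interior_subset.trans hF.subset)) fun z hz => hgf z (interior_subset hz)
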